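/- Let $a_0,a_1,d_0,d_1,k>0$ be real numbers such that \[ Y(s)=k\,\frac{a_0s^2+a_1s+1}{s\,(d_0s^2+d_1s+1)} \] is positive-real (analytic with $\operatorname{Re}Y(s)\ge 0$ for $\operatorname{Re}s>0$, and real for real $s>0$), and put $R_k=(a_0-d_0)^2-(a_0d_1-a_1d_0)(a_1-d_1)$. Then $Y(s)$ is the driving-point admittance of a two-terminal network consisting of at most three elements, each of which is a resistor, an inductor or a capacitor with positive and finite value, if and only if $R_k=0$. Moreover, if $R_k=0$, then there are $A,C>0$ such that, as rational functions, \[ Y(s)=k\,\frac{As+1}{s\,(Cs+1)}, \] and $Y(s)$ is the admittance, for suitable positive and finite element values, either of network (a), or of network (b) and also of network (c), where (a) is a single inductor, (b) is an inductor $L_1$ in parallel with the series connection of an inductor $L_2$ and a resistor $R_1$, and (c) is an inductor $L_1$ in series with the parallel connection of an inductor $L_2$ and a resistor $R_1$. -/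

import Mathlib

/-- The three kinds of two-terminal passive elements. -/
inductive ElementKind where
  | resistor
  | inductor
  | capacitor

/-- An element: its kind together with its value (resistance, inductance or capacitance), which is
positive and finite. -/
structure Element where
  kind : ElementKind
  value : ℝ
  value_pos : 0 < value

/-- The admittance of an element at the complex frequency `s`: `1/R`, `1/(L s)`, `C s`. -/
noncomputable def Element.admittance (x : Element) (s : ℂ) : ℂ :=
  match x.kind with
  | .resistor => 1 / (x.value : ℂ)
  | .inductor => 1 / ((x.value : ℂ) * s)
  | .capacitor => (x.value : ℂ) * s

/-- A two-terminal (one-port) transformerless network: an arbitrary finite multigraph with an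
element on each (arbitrarily oriented) edge and two distinguished distinct nodes, the terminals;
`m` is the number of nodes and `n` the number of elements. -/
structure Network (m n : ℕ) where
  src : Fin n → Fin m
  tgt : Fin n → Fin m
  element : Fin n → Element
  terminal : Fin m
  terminal' : Fin m
  terminal_ne : terminal ≠ terminal'

namespace Network

/-- `N.PortRelation s V I`: at the complex frequency `s`, the port voltage `V` and the port current
`I` (entering at `terminal`, leaving at `terminal'`) are compatible with the network, i.e. there
are node potentials `v` and branch currents `i` that satisfy the element laws, Kirchhoff's voltage
law (branch voltages are potential differences) and Kirchhoff's current law at each node. -/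
def PortRelation {m n : ℕ} (N : Network m n) (s V I : ℂ) : Prop :=
  ∃ (v : Fin m → ℂ) (i : Fin n → ℂ),
    (∀ e, i e = (N.element e).admittance s * (v (N.src e) - v (N.tgt e))) ∧
    (∀ x : Fin m,
      (∑ e, if N.src e = x then i e else 0) - (∑ e, if N.tgt e = x then i e else 0)
        = (if x = N.terminal then I else 0) - (if x = N.terminal' then I else 0)) ∧
    V = v N.terminal - v N.terminal'

/-- `Y` is the (driving-point) admittance of `N`: at each complex frequency in the open right
half-plane the network imposes on its port exactly the relation `I = Y(s) V`. -/
def HasAdmittance {m n : ℕ} (N : Network m n) (Y : ℂ → ℂ) : Prop :=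
  ∀ s : ℂ, 0 < s.re → ∀ V I : ℂ, N.PortRelation s V I ↔ I = Y s * V

/-- A single inductor. -/
def singleInductor (L : ℝ) (hL : 0 < L) : Network 2 1 where
  src := ![0]
  tgt := ![1]
  element := ![⟨.inductor, L, hL⟩]
  terminal := 0
  terminal' := 1
  terminal_ne := by decide

/-- The inductor `L₁` in parallel with the series connection of the inductor `L₂` and the
resistor `R₁`. -/
def parallelNetwork (L₁ L₂ R₁ : ℝ) (h₁ : 0 < L₁) (h₂ : 0 < L₂) (hR : 0 < R₁) : Network 3 3 where
  src := ![0, 0, 2]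
  tgt := ![1, 2, 1]
  element := ![⟨.inductor, L₁, h₁⟩, ⟨.inductor, L₂, h₂⟩, ⟨.resistor, R₁, hR⟩]
  terminal := 0
  terminal' := 1
  terminal_ne := by decide

/-- The inductor `L₁` in series with the parallel connection of the inductor `L₂` and the
resistor `R₁`. -/
def seriesNetwork (L₁ L₂ R₁ : ℝ) (h₁ : 0 < L₁) (h₂ : 0 < L₂) (hR : 0 < R₁) : Network 3 3 where
  src := ![0, 2, 2]
  tgt := ![2, 1, 1]
  element := ![⟨.inductor, L₁, h₁⟩, ⟨.inductor, L₂, h₂⟩, ⟨.resistor, R₁, hR⟩]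
  terminal := 0
  terminal' := 1
  terminal_ne := by decide

end Network

/-- Positive-real functions: analytic in the open right half-plane, real at positive real
arguments, with nonnegative real part in the open right half-plane. -/
def PositiveReal (Y : ℂ → ℂ) : Prop :=
  DifferentiableOn ℂ Y {s : ℂ | 0 < s.re} ∧
  (∀ x : ℝ, 0 < x → (Y (x : ℂ)).im = 0) ∧
  (∀ s : ℂ, 0 < s.re → 0 ≤ (Y s).re)

/-- `Y(s) = k (a₀ s² + a₁ s + 1) / (s (d₀ s² + d₁ s + 1))`. -/
noncomputable def specialAdmittance (a₀ a₁ d₀ d₁ k : ℝ) (s : ℂ) : ℂ :=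
  (k : ℂ) * (((a₀ : ℂ) * s ^ 2 + (a₁ : ℂ) * s + 1)
    / (s * ((d₀ : ℂ) * s ^ 2 + (d₁ : ℂ) * s + 1)))

/-- `R_k = (a₀ - d₀)² - (a₀ d₁ - a₁ d₀)(a₁ - d₁)`. -/
def resultantRk (a₀ a₁ d₀ d₁ : ℝ) : ℝ :=
  (a₀ - d₀) ^ 2 - (a₀ * d₁ - a₁ * d₀) * (a₁ - d₁)

/-! Necessity. Branch voltages range over the cut space and branch currents over the cycle space of
the graph with the port added as an edge. Their dimensions add up to the number of edges, so the
element laws form a square system, and `Y = p / q` where `p` and `q` are determinants of degree at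
most the number of reactive elements (`exists_polynomials_of_admittance`). With at most three
elements, either all are reactive and `Y` is odd, which forces `a₀ = d₀` and `a₁ = d₁`, or `p` and
`q` have degree at most 2. The latter forces a cancellation in `Y`, hence `R_k = 0`, since `R_k` is
the resultant of the two quadratics.

Sufficiency. If `R_k = 0`, the quadratics coincide and `Y = k / s`, or they share exactly one factor
`B s + 1` (`exists_common_factor`). In the second case positive-realness gives `C < A`, and partial
fractions of `Y` and of `1 / Y` have positive coefficients, giving networks (b) and (c). -/

open Polynomial Matrix

/-! ### Element laws with polynomial coefficients -/

/-- The coefficient of the voltage in the law `α u + β i = 0` of an element. -/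
noncomputable def Element.voltageCoeff (x : Element) : ℝ[X] :=
  match x.kind with
  | .resistor => -1
  | .inductor => -1
  | .capacitor => -(C x.value * X)

/-- The coefficient of the current in the law `α u + β i = 0` of an element. -/
noncomputable def Element.currentCoeff (x : Element) : ℝ[X] :=
  match x.kind with
  | .resistor => C x.value
  | .inductor => C x.value * X
  | .capacitor => 1

/-- The sign `σ` with `α(-s) = σ α(s)` and `β(-s) = -σ β(s)` for a reactive element. -/
noncomputable def Element.sign (x : Element) : ℝ :=
  match x.kind with
  | .capacitor => -1
  | _ => 1

/-- The McMillan degree of an element: `0` for resistors, `1` for reactive elements. -/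
def Element.order (x : Element) : ℕ :=
  match x.kind with
  | .resistor => 0
  | _ => 1

/-- The real admittance of an element at a real frequency. -/
noncomputable def Element.realAdmittance (x : Element) (s : ℝ) : ℝ :=
  match x.kind with
  | .resistor => 1 / x.value
  | .inductor => 1 / (x.value * s)
  | .capacitor => x.value * s

theorem Element.admittance_ofReal (x : Element) (s : ℝ) :
    x.admittance (s : ℂ) = (x.realAdmittance s : ℂ) := by
  unfold Element.admittance Element.realAdmittance
  cases x.kind <;> simp

theorem Element.realAdmittance_pos (x : Element) {s : ℝ} (hs : 0 < s) :
    0 < x.realAdmittance s := by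
  have := x.value_pos
  unfold Element.realAdmittance
  cases x.kind <;> simp only <;> positivity

theorem Element.law_iff (x : Element) {s : ℝ} (hs : 0 < s) (u i : ℝ) :
    x.voltageCoeff.eval s * u + x.currentCoeff.eval s * i = 0 ↔ i = x.realAdmittance s * u := by
  have := x.value_pos
  unfold Element.voltageCoeff Element.currentCoeff Element.realAdmittance
  cases x.kind <;> simp <;> field_simp <;> constructor <;> intro h <;> linarith

theorem Element.sign_ne_zero (x : Element) : x.sign ≠ 0 := by
  unfold Element.sign
  cases x.kind <;> simp

theorem Element.eval_neg_voltageCoeff (x : Element) (hx : x.order = 1) (s : ℝ) :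
    x.voltageCoeff.eval (-s) = x.sign * x.voltageCoeff.eval s := by
  unfold Element.order at hx
  unfold Element.voltageCoeff Element.sign
  cases h : x.kind <;> simp_all

theorem Element.eval_neg_currentCoeff (x : Element) (hx : x.order = 1) (s : ℝ) :
    x.currentCoeff.eval (-s) = x.sign * x.currentCoeff.eval s * -1 := by
  unfold Element.order at hx
  unfold Element.currentCoeff Element.sign
  cases h : x.kind <;> simp_all

theorem Element.natDegree_voltageCoeff_le (x : Element) :
    x.voltageCoeff.natDegree ≤ x.order := by
  unfold Element.order Element.voltageCoeff
  cases x.kind <;> simp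
  exact (natDegree_C_mul_le _ _).trans natDegree_X_le

theorem Element.natDegree_currentCoeff_le (x : Element) :
    x.currentCoeff.natDegree ≤ x.order := by
  unfold Element.order Element.currentCoeff
  cases x.kind <;> simp
  exact (natDegree_C_mul_le _ _).trans natDegree_X_le

theorem Element.order_le_one (x : Element) : x.order ≤ 1 := by
  unfold Element.order
  cases x.kind <;> simp

/-! ### Tableau determinants: degree, evaluation and scaling -/

section Tableau

variable {E J J' R S : Type*} [Fintype E] [DecidableEq E] [CommRing R] [CommRing S]

/-- The coefficient matrix of the equations `α e * u e + β e * i e = 0`, where `u` and `i` are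
parametrized by the columns of `B` and `B'`. -/
def tableau (B : Matrix E J R) (B' : Matrix E J' R) (f : E ≃ J ⊕ J') (α β : E → R) :
    Matrix E E R :=
  Matrix.of fun e j => Sum.elim (fun k => α e * B e k) (fun k => β e * B' e k) (f j)

omit [DecidableEq E] in
theorem tableau_mulVec [Fintype J] [Fintype J'] (B : Matrix E J R) (B' : Matrix E J' R)
    (f : E ≃ J ⊕ J') (α β w : E → R) (e : E) :
    (tableau B B' f α β *ᵥ w) e = α e * (B *ᵥ fun k => w (f.symm (.inl k))) e
      + β e * (B' *ᵥ fun k => w (f.symm (.inr k))) e := by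
  simp only [Matrix.mulVec, dotProduct, tableau, Matrix.of_apply]
  rw [← f.symm.sum_comp]
  simp [Finset.mul_sum, mul_assoc]

/-- Each term of the Leibniz expansion takes one entry from every row, and row `e` has degree at
most `d e`. -/
theorem natDegree_det_tableau_le (B : Matrix E J R) (B' : Matrix E J' R) (f : E ≃ J ⊕ J')
    (α β : E → R[X]) (d : E → ℕ) (hα : ∀ e, (α e).natDegree ≤ d e)
    (hβ : ∀ e, (β e).natDegree ≤ d e) :
    (tableau (B.map C) (B'.map C) f α β).det.natDegree ≤ ∑ e, d e := by
  rw [Matrix.det_apply']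
  refine natDegree_sum_le_of_forall_le _ _ fun σ _ => ?_
  refine natDegree_mul_le.trans ?_
  rw [natDegree_intCast, zero_add]
  rw [← Equiv.sum_comp σ d]
  refine (natDegree_prod_le _ _).trans (Finset.sum_le_sum fun e _ => ?_)
  rw [tableau, Matrix.of_apply]
  rcases f e with k | k
  · exact (natDegree_mul_C_le _ _).trans (hα _)
  · exact (natDegree_mul_C_le _ _).trans (hβ _)

theorem map_det_tableau (φ : R →+* S) (B : Matrix E J R) (B' : Matrix E J' R) (f : E ≃ J ⊕ J')
    (α β : E → R) :
    φ (tableau B B' f α β).det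
      = (tableau (B.map φ) (B'.map φ) f (fun e => φ (α e)) (fun e => φ (β e))).det := by
  rw [RingHom.map_det]
  congr 1
  ext e j
  simp only [tableau, RingHom.mapMatrix_apply, Matrix.map_apply, Matrix.of_apply]
  rcases f j with k | k <;> simp

theorem eval_det_tableau (B : Matrix E J R) (B' : Matrix E J' R) (f : E ≃ J ⊕ J')
    (α β : E → R[X]) (s : R) :
    (tableau (B.map C) (B'.map C) f α β).det.eval s
      = (tableau B B' f (fun e => (α e).eval s) (fun e => (β e).eval s)).det := by
  have := map_det_tableau (evalRingHom s) (B.map C) (B'.map C) f α β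
  rw [coe_evalRingHom] at this
  rw [this]
  congr 2 <;> ext <;> simp

/-- The factors `σ` scale rows and `τ` scales the current columns, so the matrix is multiplied by a
diagonal matrix on each side. -/
theorem det_tableau_scale (B : Matrix E J R) (B' : Matrix E J' R) (f : E ≃ J ⊕ J')
    (α β σ : E → R) (τ : R) :
    (tableau B B' f (fun e => σ e * α e) (fun e => σ e * β e * τ)).det
      = (∏ e, σ e) * (∏ j, Sum.elim (fun _ => 1) (fun _ => τ) (f j)) * (tableau B B' f α β).det := by
  have : tableau B B' f (fun e => σ e * α e) (fun e => σ e * β e * τ)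
      = diagonal σ * tableau B B' f α β
        * diagonal (fun j => Sum.elim (fun _ => 1) (fun _ => τ) (f j)) := by
    ext e j
    rw [Matrix.mul_diagonal, Matrix.diagonal_mul]
    simp only [tableau, Matrix.of_apply]
    rcases f j with k | k <;> simp <;> ring
  rw [this, Matrix.det_mul, Matrix.det_mul, Matrix.det_diagonal, Matrix.det_diagonal]
  ring

end Tableau

/-! ### The port admittance as a quotient of determinants -/

theorem Submodule.exists_matrix_mulVec_mem {E : Type*} [Fintype E] (W : Submodule ℝ (E → ℝ)) :
    ∃ (r : ℕ) (B : Matrix E (Fin r) ℝ), r = Module.finrank ℝ W ∧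
      (∀ w, B *ᵥ w ∈ W) ∧ ∀ w, B *ᵥ w = 0 → w = 0 := by
  let b := Module.finBasis ℝ W
  have key : ∀ w : Fin (Module.finrank ℝ W) → ℝ,
      (Matrix.of fun e j => (b j : E → ℝ) e) *ᵥ w = ((∑ j, w j • b j : W) : E → ℝ) := by
    intro w
    ext e
    simp [Matrix.mulVec, dotProduct, mul_comm]
  refine ⟨_, Matrix.of fun e j => (b j : E → ℝ) e, rfl, fun w => ?_, fun w hw => ?_⟩
  · rw [key]
    exact Subtype.mem _
  · rw [key] at hw
    have h0 : ∑ j, w j • b j = 0 := Subtype.ext hw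
    ext j
    exact Fintype.linearIndependent_iff.1 b.linearIndependent w h0 j

theorem Matrix.finrank_range_add_finrank_ker_transpose {E V : Type*} [Fintype E] [Fintype V]
    (M : Matrix E V ℝ) :
    Module.finrank ℝ (LinearMap.range M.mulVecLin)
      + Module.finrank ℝ (LinearMap.ker Mᵀ.mulVecLin) = Fintype.card E := by
  have h := LinearMap.finrank_range_add_finrank_ker Mᵀ.mulVecLin
  have h' : Module.finrank ℝ (LinearMap.range Mᵀ.mulVecLin)
      = Module.finrank ℝ (LinearMap.range M.mulVecLin) := Matrix.rank_transpose M
  rw [← h', h, Module.finrank_fintype_fun_eq_card]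

/-- If the elements `el` and the port are interconnected according to the matrix `M` (potentials to
voltages), and the port admittance is `y`, then `y` is a quotient of polynomials whose degrees are
at most the number of reactive elements; it is odd if all elements are reactive. -/
theorem exists_polynomials_of_admittance {ι V : Type*} [Fintype ι] [DecidableEq ι] [Fintype V]
    (M : Matrix (Option ι) V ℝ) (el : ι → Element) (y : ℝ → ℝ)
    (hy : ∀ s, 0 < s → ∀ (v : V → ℝ) (i : Option ι → ℝ), Mᵀ *ᵥ i = 0 →
      (∀ e, i (some e) = (el e).realAdmittance s * (M *ᵥ v) (some e)) →
      -i none = y s * (M *ᵥ v) none) :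
    ∃ p q : ℝ[X], (∀ s, 0 < s → q.eval s ≠ 0 ∧ p.eval s = y s * q.eval s) ∧
      p.natDegree ≤ ∑ e, (el e).order ∧ q.natDegree ≤ ∑ e, (el e).order ∧
      ((∀ e, (el e).order = 1) →
        ∃ c ≠ 0, ∀ s, q.eval (-s) = c * q.eval s ∧ p.eval (-s) = -c * p.eval s) := by
  obtain ⟨r, B, hr, hB, hB0⟩ := (LinearMap.range M.mulVecLin).exists_matrix_mulVec_mem
  obtain ⟨r', B', hr', hB', hB0'⟩ := (LinearMap.ker Mᵀ.mulVecLin).exists_matrix_mulVec_mem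
  have hcard := M.finrank_range_add_finrank_ker_transpose
  rw [← hr, ← hr'] at hcard
  -- Rank-nullity makes the tableau square: voltage and current parameters together are as many as
  -- edges, port included.
  let f : Option ι ≃ Fin r ⊕ Fin r' := Fintype.equivOfCardEq (by simpa using hcard.symm)
  let α (a : ℝ[X]) (e : Option ι) : ℝ[X] := e.elim a fun e => (el e).voltageCoeff
  let β (b : ℝ[X]) (e : Option ι) : ℝ[X] := e.elim b fun e => (el e).currentCoeff
  let T (s a b : ℝ) : Matrix (Option ι) (Option ι) ℝ :=
    tableau B B' f (fun e => e.elim a fun e => (el e).voltageCoeff.eval s)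
      (fun e => e.elim b fun e => (el e).currentCoeff.eval s)
  let D (a b : ℝ[X]) : ℝ[X] := (tableau (B.map C) (B'.map C) f (α a) (β b)).det
  have hD : ∀ (a b : ℝ[X]) (s : ℝ), (D a b).eval s = (T s (a.eval s) (b.eval s)).det := by
    intro a b s
    simp only [D, T, eval_det_tableau]
    congr 2 <;> ext e <;> cases e <;> rfl
  have hdeg : ∀ a b : ℝ, (D (C a) (C b)).natDegree ≤ ∑ e, (el e).order := by
    intro a b
    have := natDegree_det_tableau_le B B' f (α (C a)) (β (C b))
      (fun e => e.elim 0 fun e => (el e).order)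
      (by rintro (_ | e) <;> simp [α, Element.natDegree_voltageCoeff_le])
      (by rintro (_ | e) <;> simp [β, Element.natDegree_currentCoeff_le])
    simpa [D, Fintype.sum_option] using this
  have hlaw : ∀ s, 0 < s → ∀ a b w, (∀ e, (T s a b *ᵥ w) (some e) = 0) →
      ∃ u i : Option ι → ℝ, u = B *ᵥ (fun k => w (f.symm (.inl k))) ∧
        i = B' *ᵥ (fun k => w (f.symm (.inr k))) ∧ -i none = y s * u none ∧
        (T s a b *ᵥ w) none = a * u none + b * i none ∧
        (∀ e, i (some e) = (el e).realAdmittance s * u (some e)) ∧ u ⬝ᵥ i = 0 := by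
    intro s hs a b w hw
    obtain ⟨v, hv⟩ := hB fun k => w (f.symm (.inl k))
    have hi := hB' fun k => w (f.symm (.inr k))
    rw [LinearMap.mem_ker, mulVecLin_apply] at hi
    rw [mulVecLin_apply] at hv
    have hel : ∀ e, (B' *ᵥ fun k => w (f.symm (.inr k))) (some e)
        = (el e).realAdmittance s * (B *ᵥ fun k => w (f.symm (.inl k))) (some e) := by
      intro e
      have := hw e
      rw [tableau_mulVec] at this
      exact ((el e).law_iff hs _ _).1 this
    refine ⟨_, _, rfl, rfl, ?_, by rw [tableau_mulVec]; rfl, hel, ?_⟩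
    · rw [← hv]
      exact hy s hs v _ hi (by rw [hv]; exact hel)
    · rw [← hv, dotProduct_comm, dotProduct_mulVec, ← mulVec_transpose, hi, zero_dotProduct]
  -- A kernel vector has zero port voltage, hence zero port current. Tellegen's theorem `u ⬝ᵥ i = 0`
  -- then makes a sum of positive multiples of squares vanish, so all voltages and currents are
  -- zero.
  have hq : ∀ s, 0 < s → (T s 1 0).det ≠ 0 := by
    intro s hs h0
    obtain ⟨w, hw0, hw⟩ := exists_mulVec_eq_zero_iff.2 h0
    obtain ⟨u, i, hu, hi, hport, hnone, hel, htel⟩ := hlaw s hs 1 0 w (by simp [hw])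
    have hu0 : u none = 0 := by simpa [hw] using hnone.symm
    have hi0 : i none = 0 := by simpa [hu0] using hport
    have hsum : ∑ e, (el e).realAdmittance s * u (some e) ^ 2 = 0 := by
      rw [dotProduct, Fintype.sum_option, hu0, zero_mul, zero_add] at htel
      rw [← htel]
      exact Finset.sum_congr rfl fun e _ => by rw [hel]; ring
    have hu' : ∀ e, u (some e) = 0 := by
      intro e
      have hpos := (el e).realAdmittance_pos hs
      have := (Finset.sum_eq_zero_iff_of_nonneg fun e _ =>
        mul_nonneg ((el e).realAdmittance_pos hs).le (sq_nonneg _)).1 hsum e (Finset.mem_univ e)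
      simpa [hpos.ne'] using this
    have hu0 : u = 0 := by
      ext e
      rcases e with _ | e
      exacts [hu0, hu' e]
    have hi0 : i = 0 := by
      ext e
      rcases e with _ | e
      exacts [hi0, by simp [hel, hu']]
    have h1 := hB0 _ (hu.symm.trans hu0)
    have h2 := hB0' _ (hi.symm.trans hi0)
    apply hw0
    ext e
    obtain ⟨k | k, rfl⟩ := f.symm.surjective e
    · exact congrFun h1 k
    · exact congrFun h2 k
  -- The determinant is linear in the port row `(a, b)`.
  have hlin : ∀ s a b, (T s a b).det = a * (T s 1 0).det + -b * (T s 0 (-1)).det := by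
    intro s a b
    have hrow : ∀ a' b', T s a' b' = (T s a b).updateRow none (T s a' b' none) := by
      intro a' b'
      ext e j
      rcases e with _ | e
      · simp
      · rw [updateRow_ne (by simp)]
        rfl
    have : T s a b none = a • T s 1 0 none + -b • T s 0 (-1) none := by
      ext j
      simp only [T, tableau, Matrix.of_apply, Pi.add_apply, Pi.smul_apply, smul_eq_mul]
      rcases f j with k | k <;> simp
    rw [hrow a b, this, det_updateRow_add, det_updateRow_smul, det_updateRow_smul, ← hrow, ← hrow]
  have hp : ∀ s, 0 < s → (T s 0 (-1)).det = y s * (T s 1 0).det := by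
    intro s hs
    -- This port row states the port law itself, which the other rows already imply, so the vector
    -- `Pi.single none 1` cannot be attained.
    have h0 : (T s (-y s) (-1)).det = 0 := by
      by_contra hne
      have hunit : IsUnit (T s (-y s) (-1)).det := isUnit_iff_ne_zero.2 hne
      have hw : T s (-y s) (-1) *ᵥ ((T s (-y s) (-1))⁻¹ *ᵥ Pi.single none 1)
          = Pi.single none 1 := by
        rw [mulVec_mulVec, mul_nonsing_inv _ hunit, one_mulVec]
      obtain ⟨u, i, -, -, hport, hnone, -, -⟩ := hlaw s hs (-y s) (-1)
        ((T s (-y s) (-1))⁻¹ *ᵥ Pi.single none 1) fun e => by rw [hw]; simp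
      rw [hw, Pi.single_eq_same] at hnone
      linarith
    rw [hlin] at h0
    linarith
  refine ⟨D (C 0) (C (-1)), D (C 1) (C 0), fun s hs => ?_, hdeg _ _, hdeg _ _, fun hre => ?_⟩
  · simp only [hD, eval_C]
    exact ⟨hq s hs, hp s hs⟩
  · let κ : ℝ := (∏ e, (el e).sign)
      * ∏ j, Sum.elim (fun _ => (1 : ℝ)) (fun _ => -1) (f j)
    have hscale : ∀ s t a b : ℝ, (T (-s) (t * a) (t * b * -1)).det = t * κ * (T s a b).det := by
      intro s t a b
      have := det_tableau_scale B B' f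
        (fun e => e.elim a fun e => (el e).voltageCoeff.eval s)
        (fun e => e.elim b fun e => (el e).currentCoeff.eval s)
        (fun e => e.elim t fun e => (el e).sign) (-1)
      rw [Fintype.prod_option] at this
      simp only [Option.elim_none, Option.elim_some] at this
      refine Eq.trans ?_ (this.trans (by rw [mul_assoc t]))
      simp only [T]
      congr 2 <;> funext e <;> rcases e with _ | e
      · rfl
      · exact (el e).eval_neg_voltageCoeff (hre e) s
      · rfl
      · exact (el e).eval_neg_currentCoeff (hre e) s
    refine ⟨κ, ?_, fun s => ?_⟩
    · refine mul_ne_zero (Finset.prod_ne_zero_iff.2 fun e _ => (el e).sign_ne_zero)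
        (Finset.prod_ne_zero_iff.2 fun j _ => ?_)
      rcases f j with k | k <;> simp
    · simp only [hD, eval_C]
      -- The factor `t = ±1` is chosen so that the port row is the same at `-s` as at `s`.
      have h1 := hscale s 1 1 0
      have h2 := hscale s (-1) 0 (-1)
      norm_num at h1 h2
      exact ⟨h1, by rw [h2, neg_mul]⟩

/-! ### Application to networks -/

namespace Network

variable {m n : ℕ}

/-- The matrix sending node potentials to the element voltages and the port voltage. -/
noncomputable def incidence (N : Network m n) : Matrix (Option (Fin n)) (Fin m) ℝ :=
  Matrix.of fun e x => e.elim
    ((if N.terminal = x then 1 else 0) - (if N.terminal' = x then 1 else 0))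
    fun e => (if N.src e = x then 1 else 0) - (if N.tgt e = x then 1 else 0)

theorem incidence_mulVec_some (N : Network m n) (v : Fin m → ℝ) (e : Fin n) :
    (N.incidence *ᵥ v) (some e) = v (N.src e) - v (N.tgt e) := by
  simp [incidence, Matrix.mulVec, dotProduct, sub_mul, Finset.sum_sub_distrib]

theorem incidence_mulVec_none (N : Network m n) (v : Fin m → ℝ) :
    (N.incidence *ᵥ v) none = v N.terminal - v N.terminal' := by
  simp [incidence, Matrix.mulVec, dotProduct, sub_mul, Finset.sum_sub_distrib]

/-- The port is the edge `none`, oriented from `terminal` to `terminal'`; the current entering the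
network is therefore `-i none`. -/
theorem portRelation_ofReal (N : Network m n) {s : ℝ} {v : Fin m → ℝ}
    {i : Option (Fin n) → ℝ} (hi : N.incidenceᵀ *ᵥ i = 0)
    (hel : ∀ e, i (some e) = (N.element e).realAdmittance s * (N.incidence *ᵥ v) (some e)) :
    N.PortRelation s ((N.incidence *ᵥ v) none : ℝ) (-i none : ℝ) := by
  refine ⟨fun x => v x, fun e => i (some e), fun e => ?_, fun x => ?_, ?_⟩
  · beta_reduce
    rw [Element.admittance_ofReal, hel, incidence_mulVec_some]
    push_cast
    rfl
  · have h := congrFun hi x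
    simp only [incidence, Matrix.mulVec, dotProduct, Fintype.sum_option, Matrix.transpose_apply,
      Matrix.of_apply, Option.elim_none, Option.elim_some, sub_mul, ite_mul, one_mul, zero_mul,
      Finset.sum_sub_distrib, Pi.zero_apply] at h
    have h' : (∑ e, if N.src e = x then i (some e) else 0)
          - (∑ e, if N.tgt e = x then i (some e) else 0)
        = (if x = N.terminal then -i none else 0) - (if x = N.terminal' then -i none else 0) := by
      simp only [eq_comm (a := x)]
      split_ifs at h ⊢ <;> linarith
    beta_reduce
    simpa only [Complex.ofReal_sub, Complex.ofReal_sum, apply_ite Complex.ofReal,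
      Complex.ofReal_zero] using congrArg Complex.ofReal h'
  · rw [incidence_mulVec_none]
    push_cast
    rfl

theorem HasAdmittance.exists_polynomials {N : Network m n} {Y : ℂ → ℂ} (h : N.HasAdmittance Y)
    {y : ℝ → ℝ} (hy : ∀ s : ℝ, Y s = y s) :
    ∃ p q : ℝ[X], (∀ s, 0 < s → q.eval s ≠ 0 ∧ p.eval s = y s * q.eval s) ∧
      p.natDegree ≤ ∑ e, (N.element e).order ∧ q.natDegree ≤ ∑ e, (N.element e).order ∧
      ((∀ e, (N.element e).order = 1) →
        ∃ c ≠ 0, ∀ s, q.eval (-s) = c * q.eval s ∧ p.eval (-s) = -c * p.eval s) := by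
  refine exists_polynomials_of_admittance N.incidence N.element y fun s hs v i hi hel => ?_
  have := (h s (by simpa using hs) _ _).1 (N.portRelation_ofReal hi hel)
  rw [hy] at this
  exact_mod_cast this

end Network

/-! ### Necessity: the resultant vanishes -/

theorem Polynomial.eq_of_eval_eq_of_pos {p q : ℝ[X]} (h : ∀ s, 0 < s → p.eval s = q.eval s) :
    p = q :=
  Polynomial.eq_of_infinite_eval_eq p q ((Set.Ioi_infinite (0 : ℝ)).mono fun s hs => h s hs)

theorem Polynomial.eval_eq_of_natDegree_le_two {p : ℝ[X]} (hp : p.natDegree ≤ 2) (s : ℝ) :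
    p.eval s = p.coeff 0 + p.coeff 1 * s + p.coeff 2 * s ^ 2 := by
  rw [Polynomial.eval_eq_sum_range' (Nat.lt_succ_of_le hp)]
  simp [Finset.sum_range_succ]

section

variable {a₀ a₁ d₀ d₁ k : ℝ}

theorem resultantRk_eq_zero_of_natDegree_le_two (hd₀ : 0 < d₀) (hk : 0 < k) {p q : ℝ[X]}
    (hq0 : q ≠ 0) (hp : p.natDegree ≤ 2) (hq : q.natDegree ≤ 2)
    (h : ∀ s, 0 < s → k * (a₀ * s ^ 2 + a₁ * s + 1) * q.eval s
      = p.eval s * (s * (d₀ * s ^ 2 + d₁ * s + 1))) :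
    resultantRk a₀ a₁ d₀ d₁ = 0 := by
  by_contra hR
  simp only [eval_eq_of_natDegree_le_two hp, eval_eq_of_natDegree_le_two hq] at h
  -- The identity has degree at most 5, so six values determine all its coefficients.
  have h1 := h 1 (by norm_num)
  have h2 := h 2 (by norm_num)
  have h3 := h 3 (by norm_num)
  have h4 := h 4 (by norm_num)
  have h5 := h 5 (by norm_num)
  have h6 := h 6 (by norm_num)
  set q0 := q.coeff 0
  set q1 := q.coeff 1
  set q2 := q.coeff 2
  set p0 := p.coeff 0
  set p1 := p.coeff 1
  set p2 := p.coeff 2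
  have e0 : k * q0 = 0 := by linarith
  have e5 : p2 * d₀ = 0 := by linarith
  have hq00 : q0 = 0 := by simpa [hk.ne'] using e0
  have hp2 : p2 = 0 := by simpa [hd₀.ne'] using e5
  rw [hq00, hp2] at h1 h2 h3 h4 h5 h6
  have c0 : k * q1 = p0 := by linarith
  have c1 : k * q2 + k * a₁ * q1 = p1 + d₁ * p0 := by linarith
  have c2 : k * a₀ * q1 + k * a₁ * q2 = d₀ * p0 + d₁ * p1 := by linarith
  have c3 : k * a₀ * q2 = d₀ * p1 := by linarith
  unfold resultantRk at hR
  have hq1 : q1 = 0 := by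
    -- After cancelling `s`, a nonzero pair of linear cofactors solves the Sylvester system;
    -- eliminating the other unknowns leaves `q1` times the resultant.
    have : k * q1 * ((a₀ - d₀) ^ 2 - (a₀ * d₁ - a₁ * d₀) * (a₁ - d₁)) = 0 := by
      rw [← c0] at c1 c2
      linear_combination (a₁ * d₀ - a₀ * d₁) * c1 + (a₀ - d₀) * c2 - (a₁ - d₁) * c3
    simpa [hk.ne', hR] using this
  have hq2 : q2 = 0 := by
    have hp0 : p0 = 0 := by rw [← c0, hq1]; ring
    rw [hq1, hp0] at c1 c2
    have hp1 : p1 = k * q2 := by linarith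
    rw [hp1] at c2 c3
    by_contra hne
    have hne' : k * q2 ≠ 0 := mul_ne_zero hk.ne' hne
    have ha : a₁ = d₁ := mul_left_cancel₀ hne' (by linarith)
    have hb : a₀ = d₀ := mul_left_cancel₀ hne' (by linarith)
    apply hR
    rw [ha, hb]
    ring
  apply hq0
  ext j
  rcases lt_or_ge 2 j with hj | hj
  · rw [coeff_eq_zero_of_natDegree_lt (hq.trans_lt hj), coeff_zero]
  · rw [coeff_zero]
    interval_cases j
    exacts [hq00, hq1, hq2]

theorem resultantRk_eq_zero_of_odd (ha₁ : 0 < a₁) (hk : 0 < k) {p q : ℝ[X]} {c : ℝ} (hc : c ≠ 0) (hq0 : q ≠ 0)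
    (hpq : ∀ s, q.eval (-s) = c * q.eval s ∧ p.eval (-s) = -c * p.eval s)
    (h : ∀ s, 0 < s → k * (a₀ * s ^ 2 + a₁ * s + 1) * q.eval s
      = p.eval s * (s * (d₀ * s ^ 2 + d₁ * s + 1))) :
    resultantRk a₀ a₁ d₀ d₁ = 0 := by
  have hpoly : C k * (C a₀ * X ^ 2 + C a₁ * X + 1) * q
      = p * (X * (C d₀ * X ^ 2 + C d₁ * X + 1)) :=
    eq_of_eval_eq_of_pos fun s hs => by simpa using h s hs
  have hall : ∀ s, k * (a₀ * s ^ 2 + a₁ * s + 1) * q.eval s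
      = p.eval s * (s * (d₀ * s ^ 2 + d₁ * s + 1)) := fun s => by
    simpa using congrArg (eval s) hpoly
  -- Oddness of `p / q`, cross-multiplied with `p` and `q` eliminated.
  have hzero : (C a₀ * X ^ 2 - C a₁ * X + 1) * (X * (C d₀ * X ^ 2 + C d₁ * X + 1))
      - (C a₀ * X ^ 2 + C a₁ * X + 1) * (X * (C d₀ * X ^ 2 - C d₁ * X + 1)) = 0 := by
    refine (mul_eq_zero.1 (?_ : _ * q = 0)).resolve_right hq0
    refine Polynomial.funext fun s => ?_
    have h1 := hall s
    have h2 := hall (-s)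
    rw [(hpq s).1, (hpq s).2] at h2
    refine mul_left_cancel₀ (mul_ne_zero hk.ne' hc) ?_
    simp only [eval_mul, eval_sub, eval_add, eval_pow, eval_X, eval_C, eval_one, eval_zero]
    linear_combination (s * (d₀ * s ^ 2 + d₁ * s + 1)) * h2
      - c * (s * (d₀ * s ^ 2 - d₁ * s + 1)) * h1
  -- The difference equals `2 s² ((a₀ d₁ - a₁ d₀) s² + (d₁ - a₁))`, so two values suffice.
  have z1 := congrArg (eval 1) hzero
  have z2 := congrArg (eval 2) hzero
  simp only [eval_mul, eval_sub, eval_add, eval_pow, eval_X, eval_C, eval_one, eval_zero] at z1 z2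
  have h1 : a₁ = d₁ := by linarith
  have h2 : a₁ * d₀ = a₀ * d₁ := by linarith
  subst h1
  have h3 : a₀ = d₀ := mul_left_cancel₀ ha₁.ne' (by linarith)
  subst h3
  unfold resultantRk
  ring

end

section

variable {a₀ a₁ d₀ d₁ k : ℝ}

theorem specialAdmittance_ofReal (a₀ a₁ d₀ d₁ k s : ℝ) :
    specialAdmittance a₀ a₁ d₀ d₁ k (s : ℂ)
      = ((k * ((a₀ * s ^ 2 + a₁ * s + 1) / (s * (d₀ * s ^ 2 + d₁ * s + 1))) : ℝ) : ℂ) := by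
  simp [specialAdmittance]

theorem resultantRk_eq_zero_of_hasAdmittance (ha₁ : 0 < a₁)
    (hd₀ : 0 < d₀) (hd₁ : 0 < d₁) (hk : 0 < k) {m n : ℕ} {N : Network m n} (hn : n ≤ 3)
    (h : N.HasAdmittance (specialAdmittance a₀ a₁ d₀ d₁ k)) : resultantRk a₀ a₁ d₀ d₁ = 0 := by
  obtain ⟨p, q, hpq, hp, hq, hodd⟩ := h.exists_polynomials (specialAdmittance_ofReal a₀ a₁ d₀ d₁ k)
  have hq0 : q ≠ 0 := by
    rintro rfl
    exact (hpq 1 one_pos).1 eval_zero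
  have heq : ∀ s, 0 < s → k * (a₀ * s ^ 2 + a₁ * s + 1) * q.eval s
      = p.eval s * (s * (d₀ * s ^ 2 + d₁ * s + 1)) := by
    intro s hs
    have : s * (d₀ * s ^ 2 + d₁ * s + 1) ≠ 0 := by positivity
    rw [(hpq s hs).2]
    field_simp
  by_cases hre : ∀ e, (N.element e).order = 1
  · obtain ⟨c, hc, hcpq⟩ := hodd hre
    exact resultantRk_eq_zero_of_odd ha₁ hk hc hq0 hcpq heq
  · have hle : ∑ e, (N.element e).order ≤ 2 := by
      push Not at hre
      obtain ⟨e, he⟩ := hre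
      have hlt : ∑ e, (N.element e).order < ∑ _e : Fin n, 1 :=
        Finset.sum_lt_sum (fun e _ => (N.element e).order_le_one)
          ⟨e, Finset.mem_univ e, lt_of_le_of_ne (N.element e).order_le_one he⟩
      simp only [Finset.sum_const, Finset.card_univ, Fintype.card_fin, smul_eq_mul, mul_one] at hlt
      omega
    exact resultantRk_eq_zero_of_natDegree_le_two hd₀ hk hq0 (hp.trans hle) (hq.trans hle) heq

/-! ### The common factor and the sign of `A - C` -/

theorem exists_common_factor (ha₀ : 0 < a₀) (ha₁ : 0 < a₁) (hd₀ : 0 < d₀)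
    (hR : resultantRk a₀ a₁ d₀ d₁ = 0) :
    (a₀ = d₀ ∧ a₁ = d₁) ∨ ∃ A B C : ℝ, 0 < A ∧ 0 < B ∧ 0 < C ∧ A ≠ C ∧
      a₀ = A * B ∧ a₁ = A + B ∧ d₀ = C * B ∧ d₁ = C + B := by
  unfold resultantRk at hR
  rcases eq_or_ne a₁ d₁ with h₁ | h₁
  · left
    subst h₁
    have : (a₀ - d₀) ^ 2 = 0 := by linarith
    exact ⟨by linarith [pow_eq_zero_iff two_ne_zero |>.1 this], rfl⟩
  · right
    have h₁' : a₁ - d₁ ≠ 0 := sub_ne_zero.2 h₁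
    -- Subtracting the quadratics shows that a common nonzero root must be `-1 / B`.
    obtain ⟨B, hB⟩ : ∃ B, B = (a₀ - d₀) / (a₁ - d₁) := ⟨_, rfl⟩
    rw [eq_div_iff h₁'] at hB
    have hBa : B ^ 2 - a₁ * B + a₀ = 0 := by
      refine mul_left_cancel₀ (pow_ne_zero 2 h₁') ?_
      linear_combination (B * (a₁ - d₁) + (a₀ - d₀) - a₁ * (a₁ - d₁)) * hB + hR
    have hBd : B ^ 2 - d₁ * B + d₀ = 0 := by linarith
    have hBpos : 0 < B := by
      have : 0 < a₁ * B := by nlinarith [sq_nonneg B]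
      exact (pos_iff_pos_of_mul_pos this).1 ha₁
    have hAC : a₀ / B ≠ d₀ / B := by
      intro h
      rw [div_left_inj' hBpos.ne'] at h
      rw [h, sub_self, mul_eq_zero] at hB
      rcases hB with hB | hB
      exacts [hBpos.ne' hB, h₁' hB]
    refine ⟨a₀ / B, B, d₀ / B, by positivity, hBpos, by positivity, hAC, ?_, ?_, ?_, ?_⟩ <;>
      field_simp <;> linarith

theorem mul_add_one_ne_zero_of_re_pos {C : ℝ} (hC : 0 < C) {s : ℂ} (hs : 0 < s.re) :
    (C : ℂ) * s + 1 ≠ 0 := by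
  intro h
  have := congrArg Complex.re h
  simp at this
  nlinarith

theorem ne_zero_of_re_pos {s : ℂ} (hs : 0 < s.re) : s ≠ 0 := by
  rintro rfl
  simp at hs

/-- Division by `s` turns the quadratic into `d₀ s + d₁ + s⁻¹`, whose real part is positive. -/
theorem mul_sq_add_mul_add_one_ne_zero_of_re_pos (hd₀ : 0 < d₀) (hd₁ : 0 < d₁) {s : ℂ}
    (hs : 0 < s.re) : (d₀ : ℂ) * s ^ 2 + d₁ * s + 1 ≠ 0 := by
  intro h
  have h0 := ne_zero_of_re_pos hs
  have h1 : (d₀ : ℂ) * s + d₁ + s⁻¹ = 0 := by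
    field_simp
    linear_combination h
  have := congrArg Complex.re h1
  simp [Complex.inv_re] at this
  have : 0 ≤ s.re / Complex.normSq s := div_nonneg hs.le (Complex.normSq_nonneg s)
  nlinarith [mul_pos hd₀ hs]

theorem specialAdmittance_of_common_factor {A B C : ℝ} {s : ℂ}
    (hs : ((C * B : ℝ) : ℂ) * s ^ 2 + ((C + B : ℝ) : ℂ) * s + 1 ≠ 0) :
    specialAdmittance (A * B) (A + B) (C * B) (C + B) k s
      = k * ((A * s + 1) / (s * (C * s + 1))) := by
  have hd : ((C * B : ℝ) : ℂ) * s ^ 2 + ((C + B : ℝ) : ℂ) * s + 1 = (C * s + 1) * (B * s + 1) := by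
    push_cast
    ring
  have hn : ((A * B : ℝ) : ℂ) * s ^ 2 + ((A + B : ℝ) : ℂ) * s + 1 = (A * s + 1) * (B * s + 1) := by
    push_cast
    ring
  rw [hd] at hs
  rw [specialAdmittance, hd, hn, ← mul_assoc s, mul_div_mul_right _ _ (right_ne_zero_of_mul hs)]

theorem specialAdmittance_self {s : ℂ} (hs : (d₀ : ℂ) * s ^ 2 + d₁ * s + 1 ≠ 0) :
    specialAdmittance d₀ d₁ d₀ d₁ k s = k / s := by
  rw [specialAdmittance, div_mul_cancel_right₀ hs, div_eq_mul_inv]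

/-- Since `Y / k = 1 / s + (A - C) / (C s + 1)` and `1 / s` has zero real part on the imaginary
axis, the limit `s → i` reveals the sign of `A - C`. -/
theorem le_of_positiveReal {A C : ℝ} (hC : 0 < C) (hk : 0 < k) {Y : ℂ → ℂ} (hY : PositiveReal Y)
    (h : ∀ s : ℂ, 0 < s.re → Y s = k * ((A * s + 1) / (s * (C * s + 1)))) : C ≤ A := by
  have hpos : ∀ ε : ℝ, 0 < ε →
      0 ≤ ε * ((C * ε + 1) ^ 2 + C ^ 2) + (A - C) * (C * ε + 1) * (ε ^ 2 + 1) := by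
    intro ε hε
    let s : ℂ := ⟨ε, 1⟩
    have hs : 0 < s.re := hε
    have hs0 := ne_zero_of_re_pos hs
    have hs1 := mul_add_one_ne_zero_of_re_pos hC hs
    have h1 := hY.2.2 s hs
    have h2 : (A * s + 1) / (s * (C * s + 1)) = s⁻¹ + ((A - C : ℝ) : ℂ) * (C * s + 1)⁻¹ := by
      obtain ⟨W, hW⟩ : ∃ W, W = (C : ℂ) * s + 1 := ⟨_, rfl⟩
      rw [← hW] at hs1 ⊢
      push_cast
      field_simp
      linear_combination -hW
    rw [h s hs, Complex.re_ofReal_mul, h2, Complex.add_re, Complex.re_ofReal_mul, Complex.inv_re,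
      Complex.inv_re] at h1
    have h3 := (mul_nonneg_iff_of_pos_left hk).1 h1
    simp only [s, Complex.normSq_apply, Complex.add_re, Complex.add_im, Complex.mul_re,
      Complex.mul_im, Complex.ofReal_re, Complex.ofReal_im, Complex.one_re, Complex.one_im] at h3
    have e1 : 0 < ε * ε + 1 * 1 := by positivity
    have e2 : 0 < (C * ε - 0 * 1 + 1) * (C * ε - 0 * 1 + 1)
      + (C * 1 + 0 * ε + 0) * (C * 1 + 0 * ε + 0) := by
      have : 0 < C * C := by positivity
      nlinarith [sq_nonneg (C * ε + 1)]
    have h4 := mul_nonneg h3 (mul_pos e1 e2).le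
    field_simp at h4
    nlinarith [h4]
  -- With denominators cleared, the expression tends to `A - C` as `ε → 0`.
  have hcont : Continuous fun ε : ℝ =>
      ε * ((C * ε + 1) ^ 2 + C ^ 2) + (A - C) * (C * ε + 1) * (ε ^ 2 + 1) := by fun_prop
  have hlim := (hcont.tendsto 0).mono_left (nhdsWithin_le_nhds (s := Set.Ioi 0))
  have := ge_of_tendsto hlim (Filter.eventually_of_mem self_mem_nhdsWithin hpos)
  norm_num at this
  exact this

end

/-! ### Admittances of the three networks -/

namespace Network

theorem singleInductor_hasAdmittance {L : ℝ} (hL : 0 < L) {Y : ℂ → ℂ}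
    (h : ∀ s : ℂ, 0 < s.re → Y s = 1 / (L * s)) : (singleInductor L hL).HasAdmittance Y := by
  intro s hs V I
  rw [h s hs]
  constructor
  · rintro ⟨v, i, hi, hx, rfl⟩
    have h0 := hi 0
    have h1 := hx 0
    simp [singleInductor, Element.admittance] at h0 h1 ⊢
    rw [← h1, h0]
  · rintro rfl
    refine ⟨![V, 0], ![1 / (L * s) * V], ?_, ?_, ?_⟩ <;>
      simp [singleInductor, Element.admittance, Fin.forall_fin_two]

theorem parallelNetwork_hasAdmittance {L₁ L₂ R₁ : ℝ} (h₁ : 0 < L₁) (h₂ : 0 < L₂) (hR : 0 < R₁)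
    {Y : ℂ → ℂ} (h : ∀ s : ℂ, 0 < s.re → Y s = 1 / (L₁ * s) + 1 / (L₂ * s + R₁)) :
    (parallelNetwork L₁ L₂ R₁ h₁ h₂ hR).HasAdmittance Y := by
  intro s hs V I
  have hs0 := ne_zero_of_re_pos hs
  have c1 : (L₁ : ℂ) ≠ 0 := by exact_mod_cast h₁.ne'
  have c2 : (L₂ : ℂ) ≠ 0 := by exact_mod_cast h₂.ne'
  have c3 : (R₁ : ℂ) ≠ 0 := by exact_mod_cast hR.ne'
  have hne : (L₂ : ℂ) * s + R₁ ≠ 0 := by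
    intro h
    have := congrArg Complex.re h
    simp at this
    nlinarith [mul_pos h₂ hs]
  rw [h s hs]
  constructor
  · rintro ⟨v, i, hi, hx, rfl⟩
    have e0 := hi 0
    have e1 := hi 1
    have e2 := hi 2
    have k0 := hx 0
    have k2 := hx 2
    simp [parallelNetwork, Element.admittance, Fin.sum_univ_three] at e0 e1 e2 k0 k2 ⊢
    have e1' : L₂ * s * i 1 = v 0 - v 2 := by rw [e1]; field_simp
    have e2' : R₁ * i 2 = v 2 - v 1 := by rw [e2]; field_simp
    -- Kirchhoff's current law at the inner node equates the two branch currents, so the impedances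
    -- add.
    have e3 : (L₂ * s + R₁) * i 1 = v 0 - v 1 := by linear_combination e1' + e2' - R₁ * k2
    have e4 : i 1 = (L₂ * s + R₁)⁻¹ * (v 0 - v 1) := by
      rw [← e3]; field_simp
    rw [← k0, e0, e4]
    ring
  · rintro rfl
    refine ⟨![V, 0, R₁ / (L₂ * s + R₁) * V],
      ![1 / (L₁ * s) * V, 1 / (L₂ * s + R₁) * V, 1 / (L₂ * s + R₁) * V], ?_, ?_, ?_⟩
    · simp [parallelNetwork, Element.admittance, Fin.forall_fin_succ]
      constructor <;> field_simp
      ring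
    · simp [parallelNetwork, Fin.forall_fin_succ, Fin.sum_univ_three]
      constructor <;> ring
    · simp [parallelNetwork]

theorem seriesNetwork_hasAdmittance {L₁ L₂ R₁ : ℝ} (h₁ : 0 < L₁) (h₂ : 0 < L₂) (hR : 0 < R₁)
    {Y : ℂ → ℂ}
    (h : ∀ s : ℂ, 0 < s.re → Y s = 1 / (L₁ * s + L₂ * s * R₁ / (L₂ * s + R₁))) :
    (seriesNetwork L₁ L₂ R₁ h₁ h₂ hR).HasAdmittance Y := by
  intro s hs V I
  have hs0 := ne_zero_of_re_pos hs
  have c1 : (L₁ : ℂ) ≠ 0 := by exact_mod_cast h₁.ne'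
  have c2 : (L₂ : ℂ) ≠ 0 := by exact_mod_cast h₂.ne'
  have c3 : (R₁ : ℂ) ≠ 0 := by exact_mod_cast hR.ne'
  have hne : (L₂ : ℂ) * s + R₁ ≠ 0 := by
    intro h
    have := congrArg Complex.re h
    simp at this
    nlinarith [mul_pos h₂ hs]
  have hne' : (L₁ : ℂ) * (L₂ * s + R₁) + L₂ * R₁ ≠ 0 := by
    intro h
    have := congrArg Complex.re h
    simp at this
    nlinarith [mul_pos h₁ (mul_pos h₂ hs), mul_pos h₁ hR, mul_pos h₂ hR]
  obtain ⟨W, hW⟩ : ∃ W, W = (L₂ : ℂ) * s + R₁ := ⟨_, rfl⟩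
  obtain ⟨D, hD⟩ : ∃ D, D = (L₁ : ℂ) * W + L₂ * R₁ := ⟨_, rfl⟩
  have hY : Y s = W / (s * D) := by
    have : (L₁ * s + L₂ * s * R₁ / (L₂ * s + R₁) : ℂ) = s * D / W := by
      rw [← hW] at hne ⊢
      field_simp
      rw [hD]
    rw [h s hs, this, one_div_div]
  rw [← hW] at hne hne'
  rw [← hD] at hne'
  rw [hY]
  constructor
  · rintro ⟨v, i, hi, hx, rfl⟩
    have e0 := hi 0
    have e1 := hi 1
    have e2 := hi 2
    have k0 := hx 0
    have k2 := hx 2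
    simp [seriesNetwork, Element.admittance, Fin.sum_univ_three] at e0 e1 e2 k0 k2 ⊢
    have e0' : L₁ * s * i 0 = v 0 - v 2 := by rw [e0]; field_simp
    have e1' : L₂ * s * i 1 = v 2 - v 1 := by rw [e1]; field_simp
    have e2' : R₁ * i 2 = v 2 - v 1 := by rw [e2]; field_simp
    rw [← k0, div_mul_eq_mul_div, eq_div_iff (mul_ne_zero hs0 hne'), hD, hW]
    linear_combination (L₂ * s + R₁) * e0' + R₁ * e1' + L₂ * s * e2' - L₂ * s * R₁ * k2
  · rintro rfl
    refine ⟨![V, 0, L₂ * R₁ / D * V],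
      ![W / (s * D) * V,
        R₁ / (s * D) * V,
        L₂ * s / (s * D) * V], ?_, ?_, ?_⟩
    · simp [seriesNetwork, Element.admittance, Fin.forall_fin_succ]
      refine ⟨?_, ?_, ?_⟩ <;> field_simp
      linear_combination -V * hD
    · simp [seriesNetwork, Fin.forall_fin_succ, Fin.sum_univ_three]
      constructor <;> field_simp <;> rw [hW] <;> ring
    · simp [seriesNetwork]

end Network

/-! ### Realization and the main theorem -/

theorem specialAdmittance_realization {a₀ a₁ d₀ d₁ k : ℝ} (ha₀ : 0 < a₀) (ha₁ : 0 < a₁)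
    (hd₀ : 0 < d₀) (hd₁ : 0 < d₁) (hk : 0 < k)
    (hY : PositiveReal (specialAdmittance a₀ a₁ d₀ d₁ k)) (hR : resultantRk a₀ a₁ d₀ d₁ = 0) :
    (∃ A C : ℝ, 0 < A ∧ 0 < C ∧
      ∀ s : ℂ, s ≠ 0 → (d₀ : ℂ) * s ^ 2 + (d₁ : ℂ) * s + 1 ≠ 0 → (C : ℂ) * s + 1 ≠ 0 →
        specialAdmittance a₀ a₁ d₀ d₁ k s
          = (k : ℂ) * (((A : ℂ) * s + 1) / (s * ((C : ℂ) * s + 1)))) ∧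
    ((∃ (L : ℝ) (hL : 0 < L),
        (Network.singleInductor L hL).HasAdmittance (specialAdmittance a₀ a₁ d₀ d₁ k)) ∨
      ((∃ (L₁ L₂ R₁ : ℝ) (h₁ : 0 < L₁) (h₂ : 0 < L₂) (hR : 0 < R₁),
          (Network.parallelNetwork L₁ L₂ R₁ h₁ h₂ hR).HasAdmittance
            (specialAdmittance a₀ a₁ d₀ d₁ k)) ∧
        (∃ (L₁ L₂ R₁ : ℝ) (h₁ : 0 < L₁) (h₂ : 0 < L₂) (hR : 0 < R₁),
          (Network.seriesNetwork L₁ L₂ R₁ h₁ h₂ hR).HasAdmittance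
            (specialAdmittance a₀ a₁ d₀ d₁ k)))) := by
  have hden : ∀ s : ℂ, 0 < s.re → (d₀ : ℂ) * s ^ 2 + d₁ * s + 1 ≠ 0 :=
    fun s hs => mul_sq_add_mul_add_one_ne_zero_of_re_pos hd₀ hd₁ hs
  rcases exists_common_factor ha₀ ha₁ hd₀ hR with
    ⟨rfl, rfl⟩ | ⟨A, B, C, hA, -, hC, hne, rfl, rfl, rfl, rfl⟩
  · refine ⟨⟨1, 1, one_pos, one_pos, fun s hs hd h1 => ?_⟩, Or.inl ⟨1 / k, by positivity, ?_⟩⟩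
    · rw [specialAdmittance_self hd, div_mul_cancel_right₀ h1, div_eq_mul_inv]
    · refine Network.singleInductor_hasAdmittance _ fun s hs => ?_
      rw [specialAdmittance_self (hden s hs)]
      push_cast
      rw [one_div_mul_eq_div, one_div_div]
  · have hY' : ∀ s : ℂ, 0 < s.re → specialAdmittance (A * B) (A + B) (C * B) (C + B) k s
        = k * ((A * s + 1) / (s * (C * s + 1))) :=
      fun s hs => specialAdmittance_of_common_factor (hden s hs)
    have hlt : C < A := lt_of_le_of_ne (le_of_positiveReal hC hk hY hY') hne.symm
    have hAC : 0 < A - C := sub_pos.2 hlt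
    have hk' : (k : ℂ) ≠ 0 := by exact_mod_cast hk.ne'
    have hA' : (A : ℂ) ≠ 0 := by exact_mod_cast hA.ne'
    have hAC' : (A : ℂ) - C ≠ 0 := by exact_mod_cast hAC.ne'
    obtain ⟨E, hE⟩ : ∃ E, E = (A : ℂ) - C := ⟨_, rfl⟩
    rw [← hE] at hAC'
    -- Element values come from `Y = k / s + k (A - C) / (C s + 1)` for (b), and from `1 / Y = C s /
    -- (k A) + (A - C) s / (k A (A s + 1))` for (c).
    refine ⟨⟨A, C, hA, hC, fun s _ hd _ => specialAdmittance_of_common_factor hd⟩, Or.inr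
      ⟨⟨1 / k, C / (k * (A - C)), 1 / (k * (A - C)), by positivity, by positivity,
        by positivity, ?_⟩, C / (k * A), (A - C) / (k * A), (A - C) / (k * A ^ 2), by positivity, by positivity,
        by positivity, ?_⟩⟩
    · refine Network.parallelNetwork_hasAdmittance _ _ _ fun s hs => ?_
      have hs0 := ne_zero_of_re_pos hs
      have hs1 := mul_add_one_ne_zero_of_re_pos hC hs
      obtain ⟨W, hW⟩ : ∃ W, W = (C : ℂ) * s + 1 := ⟨_, rfl⟩
      rw [hY' s hs]
      push_cast
      have : (C / (k * (A - C)) * s + 1 / (k * (A - C)) : ℂ) = W / (k * E) := by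
        rw [← hE, hW]
        field_simp
      rw [this, ← hW]
      rw [← hW] at hs1
      field_simp
      rw [hE, hW]
      ring
    · refine Network.seriesNetwork_hasAdmittance _ _ _ fun s hs => ?_
      have hs0 := ne_zero_of_re_pos hs
      have hs1 := mul_add_one_ne_zero_of_re_pos hA hs
      obtain ⟨W, hW⟩ : ∃ W, W = (A : ℂ) * s + 1 := ⟨_, rfl⟩
      rw [hY' s hs]
      push_cast
      have h1 : ((A - C) / (k * A) * s + (A - C) / (k * A ^ 2) : ℂ) = E * W / (k * A ^ 2) := by
        rw [← hE, hW]
        field_simp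
      rw [← hW] at hs1
      have h2 : (C / (k * A) * s + (A - C) / (k * A) * s * ((A - C) / (k * A ^ 2))
          / (E * W / (k * A ^ 2)) : ℂ) = s * (C * s + 1) / (k * W) := by
        rw [← hE]
        field_simp
        rw [hE, hW]
        ring
      rw [h1, h2, ← hW, one_div_div, mul_div_assoc]

theorem lemma8 (a₀ a₁ d₀ d₁ k : ℝ) (ha₀ : 0 < a₀) (ha₁ : 0 < a₁) (hd₀ : 0 < d₀) (hd₁ : 0 < d₁)
    (hk : 0 < k) (hY : PositiveReal (specialAdmittance a₀ a₁ d₀ d₁ k)) :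
    ((∃ (m n : ℕ) (N : Network m n),
        n ≤ 3 ∧ N.HasAdmittance (specialAdmittance a₀ a₁ d₀ d₁ k))
      ↔ resultantRk a₀ a₁ d₀ d₁ = 0) ∧
    (resultantRk a₀ a₁ d₀ d₁ = 0 →
      (∃ A C : ℝ, 0 < A ∧ 0 < C ∧
        ∀ s : ℂ, s ≠ 0 → (d₀ : ℂ) * s ^ 2 + (d₁ : ℂ) * s + 1 ≠ 0 → (C : ℂ) * s + 1 ≠ 0 →
          specialAdmittance a₀ a₁ d₀ d₁ k s
            = (k : ℂ) * (((A : ℂ) * s + 1) / (s * ((C : ℂ) * s + 1)))) ∧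
      ((∃ (L : ℝ) (hL : 0 < L),
          (Network.singleInductor L hL).HasAdmittance (specialAdmittance a₀ a₁ d₀ d₁ k)) ∨
        ((∃ (L₁ L₂ R₁ : ℝ) (h₁ : 0 < L₁) (h₂ : 0 < L₂) (hR : 0 < R₁),
            (Network.parallelNetwork L₁ L₂ R₁ h₁ h₂ hR).HasAdmittance
              (specialAdmittance a₀ a₁ d₀ d₁ k)) ∧
          (∃ (L₁ L₂ R₁ : ℝ) (h₁ : 0 < L₁) (h₂ : 0 < L₂) (hR : 0 < R₁),
            (Network.seriesNetwork L₁ L₂ R₁ h₁ h₂ hR).HasAdmittance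
              (specialAdmittance a₀ a₁ d₀ d₁ k))))) := by
  have hreal : resultantRk a₀ a₁ d₀ d₁ = 0 → _ :=
    specialAdmittance_realization ha₀ ha₁ hd₀ hd₁ hk hY
  refine ⟨⟨?_, fun hR => ?_⟩, hreal⟩
  · rintro ⟨m, n, N, hn, hN⟩
    exact resultantRk_eq_zero_of_hasAdmittance ha₁ hd₀ hd₁ hk hn hN
  · obtain ⟨-, ⟨L, hL, h⟩ | ⟨⟨L₁, L₂, R₁, h₁, h₂, hR, h⟩, -⟩⟩ := hreal hR
    · exact ⟨2, 1, _, by norm_num, h⟩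
    · exact ⟨3, 3, _, le_rfl, h⟩
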